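/- Let $X$ be a quasi-complete Hausdorff locally convex space over $\mathbb{C}$, let $t_0>0$, and let $(T(t))_{t\ge 0}$ be a family of maps from $X$ to $X$. Write $\mathcal{L}(X)$ for the continuous linear operators on $X$. Recall that a family $(T(t))_{t\ge0}$ in $\mathcal{L}(X)$ is a semigroup if $T(0)=\mathrm{id}$ and $T(t+s)=T(t)T(s)$ for all $t,s\ge 0$; it is strongly continuous if $t\mapsto T(t)x$ is continuous on $[0,\infty)$ for every $x\in X$; it is locally equicontinuous if for every continuous seminorm $q$ on $X$ and every $t_1\ge 0$ there are a continuous seminorm $p$ on $X$ and $C\ge 0$ with $q(T(t)x)\le C\,p(x)$ for all $t\in[0,t_1]$ and $x\in X$; it is periodic if $T(s)=\mathrm{id}$ for some $s>0$, and its period is then $\rho:=\inf\{s>0 \mid T(s)=\mathrm{id}\}$. Its generator $(A,D(A))$ is given by $Ax:=\lim_{t\to0+}\frac{T(t)x-x}{t}$ on the set $D(A)$ of all $x\in X$ for which this limit exists in $X$, and the point spectrum of $A$ is $\sigma_{\mathrm p}(A):=\{\lambda\in\mathbb{C}\mid \lambda-A\colon D(A)\to X \text{ is not injective}\}$. The following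 assertions are equivalent. (a) $(T(t))_{t\ge0}$ is a periodic strongly continuous locally equicontinuous semigroup in $\mathcal{L}(X)$ whose generator $(A,D(A))$ satisfies $D(A)=X$, whose point spectrum $\sigma_{\mathrm p}(A)$ is bounded, and whose period is $\rho=\frac{t_0}{k}$ for some integer $k\ge1$. (b) There are an integer $m\ge 1$ and projections $P_n\in\mathcal{L}(X)$ (that is, $P_n^2=P_n$), $-m\le n\le m$, such that (i) $P_nP_j=0$ for all $-m\le n,j\le m$ with $j\ne n$; (ii) $P_{-m}\ne0$ or $P_m\ne0$; (iii) $\sum_{n=-m}^{m}P_n=\mathrm{id}$; (iv) $T(t)=\sum_{n=-m}^{m}\mathrm{e}^{\frac{2\pi \mathrm{i} n t}{t_0}}P_n$ for all $t\ge0$. If these equivalent assertions hold, then, with $m$ and $P_n$ as in (b), $D(A)=X$ and $A=\sum_{n=-m}^{m}\frac{2\pi \mathrm{i} n}{t_0}P_n\in\mathcal{L}(X)$. -/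

import Mathlib

open Filter Topology
open scoped NNReal

noncomputable section

namespace LCSemigroup

section Families

variable {X : Type*} [AddCommGroup X] [Module ℂ X] [TopologicalSpace X]

/-- A family `(T(t))_{t ≥ 0}` of continuous linear operators is a semigroup if
`T(0) = id` and `T(t + s) = T(t) T(s)` for all `t, s ≥ 0`. -/
structure IsSemigroup (T : ℝ≥0 → X →L[ℂ] X) : Prop where
  map_zero : T 0 = ContinuousLinearMap.id ℂ X
  map_add : ∀ t s : ℝ≥0, T (t + s) = (T t).comp (T s)

/-- Strong continuity: `t ↦ T(t)` is continuous on `[0, ∞)` for the topology of pointwise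
convergence, i.e. every orbit is continuous. -/
def StronglyContinuous (T : ℝ≥0 → X →L[ℂ] X) : Prop :=
  ∀ x : X, Continuous fun t : ℝ≥0 => T t x

/-- Local equicontinuity, with respect to the fundamental system of all continuous seminorms. -/
def LocallyEquicontinuous (T : ℝ≥0 → X →L[ℂ] X) : Prop :=
  ∀ q : Seminorm ℂ X, Continuous q → ∀ t₁ : ℝ≥0,
    ∃ p : Seminorm ℂ X, Continuous p ∧ ∃ C : ℝ, 0 ≤ C ∧
      ∀ t : ℝ≥0, t ≤ t₁ → ∀ x : X, q (T t x) ≤ C * p x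

/-- A family of operators is periodic if `T(s) = id` for some `s > 0`. -/
def IsPeriodic (T : ℝ≥0 → X →L[ℂ] X) : Prop :=
  ∃ s : ℝ≥0, 0 < s ∧ T s = ContinuousLinearMap.id ℂ X

/-- The (minimal) period `inf {s > 0 | T(s) = id}` of a periodic family of operators. -/
def period (T : ℝ≥0 → X →L[ℂ] X) : ℝ≥0 :=
  sInf {s : ℝ≥0 | 0 < s ∧ T s = ContinuousLinearMap.id ℂ X}

/-- `y` is the limit of `(T(t)x - x)/t` as `t → 0+`. -/
def HasRightDerivAtZero (T : ℝ≥0 → X →L[ℂ] X) (x y : X) : Prop :=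
  Tendsto (fun t : ℝ≥0 => (((t : ℝ) : ℂ))⁻¹ • (T t x - x)) (𝓝[>] (0 : ℝ≥0)) (𝓝 y)

/-- The point spectrum of a linear operator `(A, D(A))`: all `μ ∈ ℂ` such that
`μ - A : D(A) → X` is not injective. -/
def pointSpectrum (A : X →ₗ.[ℂ] X) : Set ℂ :=
  {μ : ℂ | ¬ Function.Injective fun x : A.domain => μ • (x : X) - A x}

end Families

section Generator

variable {X : Type*} [AddCommGroup X] [Module ℂ X] [TopologicalSpace X]
  [IsTopologicalAddGroup X] [ContinuousSMul ℂ X]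

theorem HasRightDerivAtZero.add {T : ℝ≥0 → X →L[ℂ] X} {x x' y y' : X}
    (h : HasRightDerivAtZero T x y) (h' : HasRightDerivAtZero T x' y') :
    HasRightDerivAtZero T (x + x') (y + y') := by
  refine (Tendsto.add h h').congr fun t => ?_
  rw [← smul_add, map_add]
  congr 1
  abel

theorem HasRightDerivAtZero.smul {T : ℝ≥0 → X →L[ℂ] X} {x y : X} (c : ℂ)
    (h : HasRightDerivAtZero T x y) : HasRightDerivAtZero T (c • x) (c • y) := by
  refine (Tendsto.const_smul h c).congr fun t => ?_
  rw [smul_comm, map_smul, smul_sub]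

theorem HasRightDerivAtZero.zero (T : ℝ≥0 → X →L[ℂ] X) : HasRightDerivAtZero T 0 0 := by
  simpa [HasRightDerivAtZero] using
    (tendsto_const_nhds : Tendsto (fun _ : ℝ≥0 => (0 : X)) (𝓝[>] (0 : ℝ≥0)) (𝓝 0))

theorem HasRightDerivAtZero.unique [T2Space X] {T : ℝ≥0 → X →L[ℂ] X} {x y y' : X}
    (h : HasRightDerivAtZero T x y) (h' : HasRightDerivAtZero T x y') : y = y' :=
  tendsto_nhds_unique h h'

/-- The generator `(A, D(A))` of a family of operators: `D(A)` is the set of all `x` for which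
`lim_{t → 0+} (T(t)x - x)/t` exists, and `A x` is that limit. -/
def generator [T2Space X] (T : ℝ≥0 → X →L[ℂ] X) : X →ₗ.[ℂ] X where
  domain :=
    { carrier := {x | ∃ y, HasRightDerivAtZero T x y}
      add_mem' := fun ⟨_, h⟩ ⟨_, h'⟩ => ⟨_, h.add h'⟩
      zero_mem' := ⟨_, HasRightDerivAtZero.zero T⟩
      smul_mem' := fun c _ ⟨_, h⟩ => ⟨_, h.smul c⟩ }
  toFun :=
    { toFun := fun x => Classical.choose x.2
      map_add' := fun x x' => (Classical.choose_spec (x + x').2).unique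
        ((Classical.choose_spec x.2).add (Classical.choose_spec x'.2))
      map_smul' := fun c x => (Classical.choose_spec (c • x).2).unique
        ((Classical.choose_spec x.2).smul c) }

/-- The generator is characterised by its graph. -/
theorem mem_graph_generator_iff [T2Space X] (T : ℝ≥0 → X →L[ℂ] X) (x y : X) :
    (x, y) ∈ (generator T).graph ↔ HasRightDerivAtZero T x y := by
  rw [LinearPMap.mem_graph_iff]
  constructor
  · rintro ⟨z, hz, hy⟩
    have hd : HasRightDerivAtZero T z (generator T z) := Classical.choose_spec z.2
    simp only at hz hy
    rwa [hz, hy] at hd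
  · intro h
    exact ⟨⟨x, ⟨y, h⟩⟩, rfl,
      HasRightDerivAtZero.unique (Classical.choose_spec (⟨y, h⟩ : ∃ y, _)) h⟩

end Generator

/-- The family of maps `T` is given by `T(t) = ∑_{n=-m}^{m} e^{2πint/t₀} P_n` with projections
`P_n`, `-m ≤ n ≤ m`, that are mutually orthogonal, sum up to the identity and satisfy
`P_{-m} ≠ 0` or `P_m ≠ 0`. The values of `P` at integers outside of `[-m, m]` are irrelevant. -/
structure IsFiniteFourierExpansion {X : Type*} [AddCommGroup X] [Module ℂ X] [TopologicalSpace X]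
    [IsTopologicalAddGroup X] (t₀ : ℝ) (T : ℝ≥0 → X → X) (m : ℕ) (P : ℤ → X →L[ℂ] X) :
    Prop where
  proj : ∀ n ∈ Finset.Icc (-(m : ℤ)) m, (P n).comp (P n) = P n
  orthogonal : ∀ n ∈ Finset.Icc (-(m : ℤ)) m, ∀ j ∈ Finset.Icc (-(m : ℤ)) m,
    j ≠ n → (P n).comp (P j) = 0
  extreme_ne_zero : P (-(m : ℤ)) ≠ 0 ∨ P m ≠ 0
  sum_eq_id : ∑ n ∈ Finset.Icc (-(m : ℤ)) m, P n = ContinuousLinearMap.id ℂ X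
  expansion : ∀ (t : ℝ≥0) (x : X), T t x =
    ∑ n ∈ Finset.Icc (-(m : ℤ)) m,
      Complex.exp (2 * Real.pi * Complex.I * n * (t : ℝ) / t₀) • P n x

end LCSemigroup

end

/-! From (a) to (b): since `T(t₀) = id`, the semigroup descends to a strongly continuous action of
the circle `ℝ / t₀ℤ`, and `P_n` is its `n`-th Fourier coefficient, the mean of `e^{-2πint/t₀} T(t)`
over a period. The mean exists as a limit of Riemann means by quasi-completeness and is a continuous
operator by local equicontinuity (`exists_fourierCoeff_operator`). Invariance of Haar measure makes
each nonzero vector in the range of `P_n` an eigenvector of `A` for `2πin/t₀`, so a bounded point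
spectrum leaves only finitely many `P_n ≠ 0`. For every functional `f`, the function `f(T(t)x)` then
equals its finite Fourier sum, and Hahn–Banach lifts the expansion to `X` (`circleAction_eq_sum`).
Orthogonality of characters gives the relations between the `P_n`.

From (b) to (a): everything is read off the finite sum. In particular `T(t) = id` iff `nt ∈ t₀ℤ`
whenever `P_n ≠ 0`, so the period is `t₀` divided by the gcd of these `n` (`exists_period_eq`). -/

namespace LCSemigroup

/-! ### Riemann means of vector-valued functions -/

section RiemannMean

open scoped ComplexOrder in
/-- A complex vector space that is locally convex over `ℝ` is locally convex over `ℂ`. -/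
theorem locallyConvexSpace_complex (X : Type*) [AddCommGroup X] [Module ℂ X] [Module ℝ X]
    [IsScalarTower ℝ ℂ X] [TopologicalSpace X] [LocallyConvexSpace ℝ X] :
    LocallyConvexSpace ℂ X where
  convex_basis x := by
    refine (LocallyConvexSpace.convex_basis (𝕜 := ℝ) x).to_hasBasis
      (fun s hs => ⟨s, ⟨hs.1, ?_⟩, subset_rfl⟩) fun s hs => ⟨s, ⟨hs.1, ?_⟩, subset_rfl⟩
    · exact convex_of_nonneg_surjective_algebraMap _
        (fun c hc => by
          obtain ⟨r, hr, h⟩ := RCLike.nonneg_iff_exists_ofReal.mp (Set.mem_Ici.1 hc)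
          exact ⟨r, hr, h⟩) hs.2
    · exact hs.2.lift ℝ

variable {X : Type*} [AddCommGroup X] [Module ℂ X]

/-- The mean of the values of `g` at the `N` equidistant points `i p / N` of `[0, p)`. -/
noncomputable def riemannMean (p : ℝ) (N : ℕ) (g : ℝ → X) : X :=
  (N : ℂ)⁻¹ • ∑ i ∈ Finset.range N, g (i * (p / N))

theorem sum_range_mul_eq {M : Type*} [AddCommMonoid M] (f : ℕ → M) (a b : ℕ) :
    ∑ i ∈ Finset.range (a * b), f i =
      ∑ i ∈ Finset.range a, ∑ j ∈ Finset.range b, f (i * b + j) := by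
  induction a with
  | zero => simp
  | succ a ih => rw [Nat.succ_mul, Finset.sum_range_add, ih, Finset.sum_range_succ]

/-- Repeating each of the `a` coarse nodes `b` times makes the difference a convex combination of
increments of `g` over distances below `p / a`. -/
theorem riemannMean_sub_riemannMean_mul_mem [Module ℝ X] [IsScalarTower ℝ ℂ X] {V : Set X}
    (hV : Convex ℝ V) {p δ : ℝ} (hp : 0 < p) {g : ℝ → X}
    (hg : ∀ s t, |s - t| < δ → g s - g t ∈ V) {a b : ℕ} (ha : 0 < a) (hb : 0 < b)
    (hδ : p / a < δ) : riemannMean p a g - riemannMean p (a * b) g ∈ V := by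
  have ha' : (0 : ℝ) < a := by exact_mod_cast ha
  have hb' : (0 : ℝ) < b := by exact_mod_cast hb
  have hac : (a : ℂ) ≠ 0 := by exact_mod_cast ha.ne'
  have hbc : (b : ℂ) ≠ 0 := by exact_mod_cast hb.ne'
  have key : riemannMean p a g - riemannMean p (a * b) g =
      ∑ z ∈ Finset.range a ×ˢ Finset.range b, ((a * b : ℝ)⁻¹ : ℝ) •
        (g (z.1 * (p / a)) - g (((z.1 * b + z.2 : ℕ) : ℝ) * (p / (a * b : ℕ)))) := by
    rw [← Finset.smul_sum, Finset.sum_sub_distrib, Finset.sum_product, Finset.sum_product,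
      ← sum_range_mul_eq (fun i => g ((i : ℝ) * (p / (a * b : ℕ)))), smul_sub]
    simp only [riemannMean, Finset.sum_const, Finset.card_range]
    rw [← Finset.smul_sum, ← Nat.cast_smul_eq_nsmul ℂ, ← algebraMap_smul ℂ (_ : ℝ),
      ← algebraMap_smul ℂ (_ : ℝ), smul_smul]
    congr 2
    · simp; field_simp
    · simp
  rw [key]
  refine hV.sum_mem (fun _ _ => by positivity) ?_ fun z hz => hg _ _ ?_
  · simp; field_simp
  · rw [Finset.mem_product, Finset.mem_range, Finset.mem_range] at hz
    have hz2 : (z.2 : ℝ) < b := by exact_mod_cast hz.2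
    have : (z.1 : ℝ) * (p / a) - ((z.1 * b + z.2 : ℕ) : ℝ) * (p / (a * b : ℕ)) =
        - (z.2 / b * (p / a)) := by
      push_cast; field_simp; ring
    rw [this, abs_neg, abs_of_nonneg (by positivity)]
    refine lt_of_le_of_lt ?_ hδ
    have h1 : (z.2 : ℝ) / b ≤ 1 := by rw [div_le_one hb']; exact hz2.le
    have h2 : 0 ≤ p / a := by positivity
    nlinarith

theorem cauchySeq_riemannMean [Module ℝ X] [IsScalarTower ℝ ℂ X] [UniformSpace X]
    [IsUniformAddGroup X] [LocallyConvexSpace ℝ X] {p : ℝ} (hp : 0 < p) {g : ℝ → X}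
    (hg : UniformContinuous g) : CauchySeq fun N : ℕ => riemannMean p (N + 1) g := by
  rw [cauchySeq_iff]
  intro E hE
  rw [uniformity_eq_comap_nhds_zero_swapped X] at hE
  obtain ⟨U, hU, hUE⟩ := hE
  obtain ⟨U', hU', hUU⟩ := exists_nhds_half_neg hU
  obtain ⟨V, ⟨hV0, hV⟩, hVU⟩ := (LocallyConvexSpace.convex_basis_zero ℝ X).mem_iff.1 hU'
  have hE' : {z : X × X | z.1 - z.2 ∈ V} ∈ uniformity X := by
    rw [uniformity_eq_comap_nhds_zero_swapped X]
    exact ⟨V, hV0, fun _ h => h⟩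
  obtain ⟨δ, hδ, h⟩ := Metric.mem_uniformity_dist.1 (hg hE')
  have hgV : ∀ s t, |s - t| < δ → g s - g t ∈ V := fun s t hst => h (by rwa [Real.dist_eq])
  obtain ⟨N, hN⟩ := exists_nat_gt (p / δ)
  have hsmall : ∀ k : ℕ, N ≤ k → p / ((k + 1 : ℕ) : ℝ) < δ := fun k hk => by
    have : (N : ℝ) ≤ k := by exact_mod_cast hk
    rw [div_lt_iff₀ hδ] at hN
    rw [div_lt_iff₀ (by positivity)]
    push_cast
    nlinarith
  refine ⟨N, fun k hk l hl => hUE ?_⟩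
  -- Both means are compared with the mean over the common refinement into `(k + 1)(l + 1)` points.
  have h1 := riemannMean_sub_riemannMean_mul_mem hV hp hgV k.succ_pos l.succ_pos (hsmall k hk)
  have h2 := riemannMean_sub_riemannMean_mul_mem hV hp hgV l.succ_pos k.succ_pos (hsmall l hl)
  rw [mul_comm] at h2
  have := hUU _ (hVU h1) _ (hVU h2)
  simpa using this

/-- A Cauchy sequence has totally bounded range, whose closure is compact in a quasi-complete space.
-/
theorem exists_tendsto_riemannMean [Module ℝ X] [IsScalarTower ℝ ℂ X] [UniformSpace X]
    [IsUniformAddGroup X] [ContinuousSMul ℂ X] [LocallyConvexSpace ℝ X] [QuasiCompleteSpace ℂ X]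
    {p : ℝ} (hp : 0 < p) {g : ℝ → X} (hg : UniformContinuous g) :
    ∃ y, Tendsto (fun N : ℕ => riemannMean p (N + 1) g) atTop (𝓝 y) := by
  have hc := cauchySeq_riemannMean hp hg
  obtain ⟨y, -, hy⟩ := cauchySeq_tendsto_of_isComplete
    (isCompact_closure_of_totallyBounded_quasiComplete (𝕜 := ℂ) hc.totallyBounded_range).isComplete
    (fun n => subset_closure (Set.mem_range_self n)) hc
  exact ⟨y, hy⟩

theorem tendsto_riemannMean_integral {p : ℝ} (hp : 0 < p) {F : ℝ → ℂ}
    (hF : UniformContinuous F) :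
    Tendsto (fun N : ℕ => riemannMean p (N + 1) F) atTop
      (𝓝 ((1 / p) • ∫ t in (0 : ℝ)..0 + p, F t)) := by
  rw [Metric.tendsto_atTop]
  intro ε hε
  obtain ⟨δ, hδ, h⟩ := Metric.uniformContinuous_iff.1 hF (ε / 2) (by positivity)
  obtain ⟨N, hN⟩ := exists_nat_gt (p / δ)
  refine ⟨N, fun k hk => ?_⟩
  set n : ℕ := k + 1 with hn
  have hn0 : (0 : ℝ) < n := by positivity
  have hsmall : p / n < δ := by
    have : (N : ℝ) ≤ k := by exact_mod_cast hk
    rw [div_lt_iff₀ hδ] at hN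
    rw [div_lt_iff₀ hn0, hn]
    push_cast
    nlinarith
  have hint : ∀ a b : ℝ, IntervalIntegrable F MeasureTheory.volume a b :=
    fun a b => hF.continuous.intervalIntegrable a b
  have hsum := intervalIntegral.sum_integral_adjacent_intervals (f := F)
    (μ := MeasureTheory.volume) (a := fun i : ℕ => (i : ℝ) * (p / n)) (n := n)
    fun _ _ => hint _ _
  have hend : (n : ℝ) * (p / n) = 0 + p := by field_simp; simp
  simp only [hend, Nat.cast_zero, zero_mul] at hsum
  have hmean : riemannMean p n F = (1 / p) • ∑ i ∈ Finset.range n,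
      ∫ _ in ((i : ℝ) * (p / n))..(((i + 1 : ℕ) : ℝ) * (p / n)), F (i * (p / n)) := by
    simp only [intervalIntegral.integral_const, riemannMean]
    rw [Finset.smul_sum, Finset.smul_sum]
    refine Finset.sum_congr rfl fun i _ => ?_
    have : (((i + 1 : ℕ) : ℝ) * (p / n) - i * (p / n)) = p / n := by push_cast; ring
    rw [this, smul_smul]
    have : 1 / p * (p / n) = (n : ℝ)⁻¹ := by field_simp
    rw [this, Complex.real_smul]
    simp
  rw [← hsum, hmean, dist_eq_norm, ← smul_sub, ← Finset.sum_sub_distrib, norm_smul]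
  have hbd : ∀ i ∈ Finset.range n,
      ‖(∫ _ in ((i : ℝ) * (p / n))..(((i + 1 : ℕ) : ℝ) * (p / n)), F (i * (p / n))) -
        ∫ t in ((i : ℝ) * (p / n))..(((i + 1 : ℕ) : ℝ) * (p / n)), F t‖ ≤ ε / 2 * (p / n) := by
    intro i _
    have hw : (((i + 1 : ℕ) : ℝ) * (p / n) - i * (p / n)) = p / n := by push_cast; ring
    have hpn : 0 < p / n := by positivity
    rw [← intervalIntegral.integral_sub (by simp) (hint _ _)]
    refine (intervalIntegral.norm_integral_le_of_norm_le_const (C := ε / 2) fun t ht => ?_).trans ?_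
    · rw [Set.uIoc_of_le (by linarith)] at ht
      rw [← dist_eq_norm]
      refine (h ?_).le
      rw [dist_comm, Real.dist_eq, abs_of_nonneg (by linarith [ht.1])]
      linarith [ht.2]
    · rw [hw, abs_of_pos hpn]
  refine (mul_le_mul_of_nonneg_left (norm_sum_le_of_le _ hbd) (norm_nonneg _)).trans_lt ?_
  rw [Finset.sum_const, Finset.card_range, nsmul_eq_mul, Real.norm_of_nonneg (by positivity)]
  have : 1 / p * (n * (ε / 2 * (p / n))) = ε / 2 := by field_simp
  rw [this]
  linarith

end RiemannMean

/-! ### The action of the circle induced by a periodic semigroup -/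

section CircleAction

variable {X : Type*} [AddCommGroup X] [Module ℂ X] [TopologicalSpace X]
  {p : ℝ} [Fact (0 < p)] {S : ℝ≥0 → X →L[ℂ] X}

/-- The family of operators indexed by the circle `ℝ / pℤ` that agrees with `S` on `[0, p)`. -/
noncomputable def circleAction (p : ℝ) [Fact (0 < p)] (S : ℝ≥0 → X →L[ℂ] X) (a : AddCircle p) :
    X →L[ℂ] X :=
  AddCircle.liftIco p 0 (fun t : ℝ => S t.toNNReal) a

theorem IsSemigroup.map_add_nsmul_of_eq_id (hS : IsSemigroup S) {r : ℝ≥0}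
    (hr : S r = ContinuousLinearMap.id ℂ X) (t : ℝ≥0) (n : ℕ) : S (t + n • r) = S t := by
  induction n with
  | zero => simp
  | succ n ih => rw [succ_nsmul, ← add_assoc, hS.map_add, hr, ih, ContinuousLinearMap.comp_id]

theorem circleAction_coe (hS : IsSemigroup S)
    (hp : S p.toNNReal = ContinuousLinearMap.id ℂ X) (t : ℝ≥0) :
    circleAction p S ((t : ℝ) : AddCircle p) = S t := by
  have hp0 : 0 < p := Fact.out
  -- The number of periods split off from `t ≥ 0` is nonnegative, so it can be written as a natural
  -- multiple of `p`, as the semigroup law requires.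
  have h0 : 0 ≤ toIcoDiv hp0 0 (t : ℝ) := by
    by_contra! h
    have h1 := (toIcoMod_mem_Ico hp0 0 (t : ℝ)).2
    have h2 := toIcoMod_add_toIcoDiv_zsmul hp0 0 (t : ℝ)
    have h3 : ((toIcoDiv hp0 0 (t : ℝ) : ℤ) : ℝ) ≤ -1 := by exact_mod_cast Int.le_sub_one_of_lt h
    rw [zsmul_eq_mul] at h2
    have h4 := t.2
    have h5 : (t : ℝ) = t.1 := rfl
    nlinarith
  obtain ⟨n, hn⟩ := Int.eq_ofNat_of_zero_le h0
  have hmem := toIcoMod_mem_Ico hp0 0 (t : ℝ)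
  have hdec := toIcoMod_add_toIcoDiv_zsmul hp0 0 (t : ℝ)
  set r := toIcoMod hp0 0 (t : ℝ)
  have ht : t = r.toNNReal + n • p.toNNReal := by
    apply NNReal.coe_injective
    push_cast
    rw [Real.coe_toNNReal _ hmem.1, Real.coe_toNNReal _ hp0.le, ← hdec, hn]
    simp
  have hcoe : ((t : ℝ) : AddCircle p) = (r : AddCircle p) := by
    rw [← hdec, hn]
    simp [AddCircle.coe_period]
  rw [hcoe, circleAction, AddCircle.liftIco_coe_apply hmem]
  conv_rhs => rw [ht]
  exact (hS.map_add_nsmul_of_eq_id hp _ n).symm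

theorem exists_nnreal_coe_eq (a : AddCircle p) : ∃ t : ℝ≥0, ((t : ℝ) : AddCircle p) = a := by
  obtain ⟨b, hb, rfl⟩ := AddCircle.eq_coe_Ico a
  exact ⟨⟨b, hb.1⟩, rfl⟩

theorem circleAction_add (hS : IsSemigroup S)
    (hp : S p.toNNReal = ContinuousLinearMap.id ℂ X) (a b : AddCircle p) :
    circleAction p S (a + b) = (circleAction p S a).comp (circleAction p S b) := by
  obtain ⟨s, rfl⟩ := exists_nnreal_coe_eq a
  obtain ⟨t, rfl⟩ := exists_nnreal_coe_eq b
  rw [← AddCircle.coe_add, ← NNReal.coe_add, circleAction_coe hS hp, circleAction_coe hS hp,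
    circleAction_coe hS hp, hS.map_add]

theorem continuous_circleAction (hS : IsSemigroup S) (hc : StronglyContinuous S)
    (hp : S p.toNNReal = ContinuousLinearMap.id ℂ X) (x : X) :
    Continuous fun a => circleAction p S a x := by
  have : (fun a => circleAction p S a x) =
      AddCircle.liftIco p 0 fun t : ℝ => S t.toNNReal x := by
    ext a
    rfl
  rw [this]
  refine AddCircle.liftIco_zero_continuous ?_ ((hc x).comp continuous_real_toNNReal).continuousOn
  simp [hp, hS.map_zero]

end CircleAction

/-! ### Fourier coefficients as continuous operators -/

section SpectralProjection

theorem uniformContinuous_comp_coe {Y : Type*} [UniformSpace Y] {p : ℝ} [Fact (0 < p)]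
    {h : AddCircle p → Y} (hh : Continuous h) :
    UniformContinuous fun t : ℝ => h t := by
  have h1 := CompactSpace.uniformContinuous_of_continuous hh
  have h2 : UniformContinuous (QuotientAddGroup.mk' (AddSubgroup.zmultiples p)) :=
    uniformContinuous_addMonoidHom_of_continuous (AddCircle.continuous_mk' p)
  exact h1.comp h2

variable {X : Type*} [AddCommGroup X] [Module ℂ X] [Module ℝ X] [IsScalarTower ℝ ℂ X]
  [UniformSpace X] [IsUniformAddGroup X] [ContinuousSMul ℂ X] [LocallyConvexSpace ℝ X]
  {p : ℝ} [Fact (0 < p)] {S : ℝ≥0 → X →L[ℂ] X}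

theorem eq_of_forall_dual_apply_eq [T2Space X] {x y : X} (h : ∀ f : X →L[ℂ] ℂ, f x = f y) :
    x = y := by
  by_contra hxy
  have : ContinuousSMul ℝ X := IsScalarTower.continuousSMul ℂ
  obtain ⟨f, hf⟩ := RCLike.geometric_hahn_banach_point_point (𝕜 := ℂ) hxy
  rw [h f] at hf
  exact lt_irrefl _ hf

/-- The Riemann means are linear in `x`, and equicontinuity on `[0, p]` bounds them uniformly in
`N`; both properties pass to the limit. Functionals determine `P`, so later identities reduce to
scalar Fourier analysis. -/
theorem exists_fourierCoeff_operator [T2Space X] [QuasiCompleteSpace ℂ X] (hS : IsSemigroup S)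
    (hc : StronglyContinuous S) (he : LocallyEquicontinuous S)
    (hp : S p.toNNReal = ContinuousLinearMap.id ℂ X) (n : ℤ) :
    ∃ P : X →L[ℂ] X, ∀ (f : X →L[ℂ] ℂ) (x : X),
      f (P x) = fourierCoeff (fun a => f (circleAction p S a x)) n := by
  have hp0 : 0 < p := Fact.out
  let g : X → ℝ → X := fun x t => fourier (-n) (t : AddCircle p) • circleAction p S t x
  have hg : ∀ x, UniformContinuous (g x) := fun x =>
    uniformContinuous_comp_coe (h := fun a => fourier (-n) a • circleAction p S a x)
      ((map_continuous (fourier (-n))).smul (continuous_circleAction hS hc hp x))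
  choose L hL using fun x => exists_tendsto_riemannMean hp0 (hg x)
  have hadd : ∀ x y N, riemannMean p N (g (x + y)) =
      riemannMean p N (g x) + riemannMean p N (g y) := by
    intro x y N
    simp [riemannMean, g, Finset.sum_add_distrib]
  have hsmul : ∀ (c : ℂ) x N, riemannMean p N (g (c • x)) = c • riemannMean p N (g x) := by
    intro c x N
    simp only [riemannMean, g, map_smul, smul_comm _ c, ← Finset.smul_sum]
  let P₀ : X →ₗ[ℂ] X :=
    { toFun := L
      map_add' := fun x y => tendsto_nhds_unique (hL (x + y)) <| by
        simpa only [hadd] using (hL x).add (hL y)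
      map_smul' := fun c x => tendsto_nhds_unique (hL (c • x)) <| by
        simpa only [hsmul, RingHom.id_apply] using (hL x).const_smul c }
  have hbound : ∀ q : Seminorm ℂ X, Continuous q → Continuous (q.comp P₀) := by
    intro q hq
    obtain ⟨r, hr, C, hC, h⟩ := he q hq p.toNNReal
    have hW : ∀ (a : AddCircle p) x, q (circleAction p S a x) ≤ C * r x := by
      intro a x
      obtain ⟨b, hb, rfl⟩ := AddCircle.eq_coe_Ico a
      rw [circleAction, AddCircle.liftIco_zero_coe_apply hb]
      exact h _ (Real.toNNReal_le_toNNReal hb.2.le) x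
    have hmean : ∀ (N : ℕ) x, q (riemannMean p (N + 1) (g x)) ≤ C * r x := by
      intro N x
      rw [riemannMean, map_smul_eq_mul, norm_inv, Complex.norm_natCast,
        inv_mul_le_iff₀ (by positivity)]
      refine (Finset.le_sum_of_subadditive q (map_zero q).le (map_add_le_add q) _ _).trans ?_
      refine (Finset.sum_le_card_nsmul _ _ (C * r x) fun i _ => ?_).trans ?_
      · rw [map_smul_eq_mul, fourier_apply, Circle.norm_coe, one_mul]
        exact hW _ _
      · simp
    refine Seminorm.continuous_of_le (q := C.toNNReal • r) (hr.const_smul C.toNNReal) fun x => ?_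
    rw [smul_apply, NNReal.smul_def, Real.coe_toNNReal _ hC, smul_eq_mul]
    exact le_of_tendsto ((hq.tendsto _).comp (hL x)) (Eventually.of_forall fun N => hmean N x)
  have := locallyConvexSpace_complex X
  have : ContinuousSMul ℝ X := IsScalarTower.continuousSMul ℂ
  have : PolynormableSpace ℂ X := LocallyConvexSpace.toPolynormableSpace
  refine ⟨⟨P₀, (PolynormableSpace.withSeminorms ℂ X).continuous_of_continuous_comp P₀
    fun q => hbound q q.2⟩, fun f x => ?_⟩
  rw [fourierCoeff_eq_intervalIntegral _ _ 0]
  refine tendsto_nhds_unique ((f.continuous.tendsto _).comp (hL x)) ?_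
  have hF : UniformContinuous fun t : ℝ => f (g x t) := f.uniformContinuous.comp (hg x)
  have := tendsto_riemannMean_integral hp0 hF
  simp only [g, map_smul] at this
  refine this.congr fun N => ?_
  simp only [riemannMean, g, map_smul, map_sum, Function.comp_apply]

end SpectralProjection

/-! ### Consequences of a finite Fourier expansion -/

section Expansion

theorem tendsto_inv_mul_exp_sub_one (c : ℂ) :
    Tendsto (fun t : ℝ≥0 => ((t : ℝ) : ℂ)⁻¹ * (Complex.exp (c * (t : ℝ)) - 1))
      (𝓝[>] (0 : ℝ≥0)) (𝓝 c) := by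
  have hd : HasDerivAt (fun s : ℝ => Complex.exp (c * s)) c 0 := by
    have h1 : HasDerivAt (fun z : ℂ => Complex.exp (c * z)) c ((0 : ℝ) : ℂ) := by
      simpa using ((hasDerivAt_id ((0 : ℝ) : ℂ)).const_mul c).cexp
    exact h1.comp_ofReal
  rw [hasDerivAt_iff_tendsto_slope_zero] at hd
  have hcoe : Tendsto (fun t : ℝ≥0 => (t : ℝ)) (𝓝[>] (0 : ℝ≥0)) (𝓝[≠] (0 : ℝ)) := by
    refine tendsto_nhdsWithin_iff.2 ⟨?_, ?_⟩
    · exact (NNReal.continuous_coe.tendsto' 0 0 rfl).mono_left nhdsWithin_le_nhds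
    · filter_upwards [self_mem_nhdsWithin] with t ht
      exact (NNReal.coe_pos.2 ht).ne'
  refine (hd.comp hcoe).congr fun t => ?_
  simp

variable {X : Type*} [AddCommGroup X] [Module ℂ X] [TopologicalSpace X]
  [IsTopologicalAddGroup X] {t₀ : ℝ} {S : ℝ≥0 → X →L[ℂ] X}

variable {m : ℕ} {P : ℤ → X →L[ℂ] X}

namespace IsFiniteFourierExpansion

theorem sum_proj_apply {T : ℝ≥0 → X → X} (h : IsFiniteFourierExpansion t₀ T m P) (x : X) :
    ∑ n ∈ Finset.Icc (-(m : ℤ)) m, P n x = x := by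
  have := congrArg (fun A : X →L[ℂ] X => A x) h.sum_eq_id
  simpa using this

theorem proj_apply_sum {T : ℝ≥0 → X → X} (h : IsFiniteFourierExpansion t₀ T m P) {n : ℤ}
    (hn : n ∈ Finset.Icc (-(m : ℤ)) m) (c : ℤ → ℂ) (x : X) :
    P n (∑ j ∈ Finset.Icc (-(m : ℤ)) m, c j • P j x) = c n • P n x := by
  rw [map_sum, Finset.sum_eq_single_of_mem n hn]
  · rw [map_smul, ← ContinuousLinearMap.comp_apply, h.proj n hn]
  · intro j hj hjn
    rw [map_smul, ← ContinuousLinearMap.comp_apply, h.orthogonal n hn j hj hjn,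
      zero_apply, smul_zero]

theorem locallyEquicontinuous (h : IsFiniteFourierExpansion t₀ (fun t x => S t x) m P) :
    LocallyEquicontinuous S := by
  intro q hq _
  have hsum : ∀ x, (∑ n ∈ Finset.Icc (-(m : ℤ)) m, q.comp (P n : X →ₗ[ℂ] X)) x =
      ∑ n ∈ Finset.Icc (-(m : ℤ)) m, q (P n x) := fun x => by
    rw [sum_apply]
    rfl
  refine ⟨∑ n ∈ Finset.Icc (-(m : ℤ)) m, q.comp (P n : X →ₗ[ℂ] X), ?_, 1, zero_le_one,
    fun t _ x => ?_⟩
  · have : (⇑(∑ n ∈ Finset.Icc (-(m : ℤ)) m, q.comp (P n : X →ₗ[ℂ] X)) : X → ℝ) =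
        fun x => ∑ n ∈ Finset.Icc (-(m : ℤ)) m, q (P n x) := funext hsum
    rw [this]
    exact continuous_finsetSum _ fun n _ => hq.comp (P n).continuous
  · have hx := h.expansion t x
    rw [hx, one_mul, hsum]
    refine (Finset.le_sum_of_subadditive q (map_zero q).le (map_add_le_add q) _ _).trans ?_
    refine Finset.sum_le_sum fun n _ => ?_
    have : (2 * Real.pi * Complex.I * n * (t : ℝ) / t₀ : ℂ) =
        ((2 * Real.pi * n * t / t₀ : ℝ) : ℂ) * Complex.I := by push_cast; ring
    rw [map_smul_eq_mul, this, Complex.norm_exp_ofReal_mul_I, one_mul]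

theorem isSemigroup (h : IsFiniteFourierExpansion t₀ (fun t x => S t x) m P) :
    IsSemigroup S where
  map_zero := by
    ext x
    have := h.expansion 0 x
    simpa [h.sum_proj_apply x] using this
  map_add t s := by
    ext x
    have h1 := h.expansion (t + s) x
    have h2 := h.expansion s x
    have h3 := h.expansion t (S s x)
    rw [ContinuousLinearMap.comp_apply, h1, h3]
    refine Finset.sum_congr rfl fun n hn => ?_
    rw [h2, h.proj_apply_sum hn, smul_smul, ← Complex.exp_add]
    congr 2
    push_cast
    ring

/-- Applying `P n` to the expansion isolates one exponential, which must be `1` as soon as `P n x ≠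
0` for some `x`. -/
theorem apply_eq_id_iff (h : IsFiniteFourierExpansion t₀ (fun t x => S t x) m P) (ht₀ : 0 < t₀)
    (t : ℝ≥0) : S t = ContinuousLinearMap.id ℂ X ↔
      ∀ n ∈ Finset.Icc (-(m : ℤ)) m, P n ≠ 0 → ∃ z : ℤ, (n : ℝ) * t = z * t₀ := by
  have ht₀c : (t₀ : ℂ) ≠ 0 := by exact_mod_cast ht₀.ne'
  have hexp : ∀ n : ℤ, Complex.exp (2 * Real.pi * Complex.I * n * (t : ℝ) / t₀) = 1 ↔
      ∃ z : ℤ, (n : ℝ) * t = z * t₀ := by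
    intro n
    rw [Complex.exp_eq_one_iff]
    refine exists_congr fun z => ?_
    rw [div_eq_iff ht₀c, ← Complex.ofReal_inj]
    push_cast
    constructor
    · intro hz
      refine mul_left_cancel₀ Complex.two_pi_I_ne_zero ?_
      linear_combination hz
    · intro hz
      linear_combination (2 * Real.pi * Complex.I) * hz
  constructor
  · intro hid n hn hP
    rw [← hexp]
    obtain ⟨x, hx⟩ : ∃ x, P n x ≠ 0 := by
      by_contra! hall
      exact hP (ContinuousLinearMap.ext hall)
    have h1 := h.expansion t x
    simp only [hid, ContinuousLinearMap.id_apply] at h1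
    have h2 := congrArg (P n) h1
    rw [h.proj_apply_sum hn] at h2
    refine smul_left_injective ℂ hx ?_
    simp only [one_smul, ← h2]
  · intro hall
    ext x
    have h1 := h.expansion t x
    rw [h1, ContinuousLinearMap.id_apply]
    nth_rw 2 [← h.sum_proj_apply x]
    refine Finset.sum_congr rfl fun n hn => ?_
    by_cases hP : P n = 0
    · simp [hP]
    · rw [(hexp n).2 (hall n hn hP), one_smul]

theorem exists_period_eq (h : IsFiniteFourierExpansion t₀ (fun t x => S t x) m P) (ht₀ : 0 < t₀)
    (hm : 0 < m) : IsPeriodic S ∧ ∃ k : ℕ, 0 < k ∧ (period S : ℝ) = t₀ / k := by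
  -- The generator `d` of this ideal is the gcd of the active indices; the period will be `t₀ /
  -- |d|`.
  set J : Ideal ℤ := Ideal.span {n | n ∈ Finset.Icc (-(m : ℤ)) m ∧ P n ≠ 0} with hJ
  obtain ⟨d, hd⟩ := (inferInstance : J.IsPrincipal)
  have hdvd : ∀ n ∈ Finset.Icc (-(m : ℤ)) m, P n ≠ 0 → d ∣ n := fun n hn hP => by
    have : n ∈ J := Ideal.subset_span ⟨hn, hP⟩
    rw [hd] at this
    exact Ideal.mem_span_singleton.1 this
  have hd0 : d ≠ 0 := by
    rintro rfl
    have hm' : (m : ℤ) ≠ 0 := by exact_mod_cast hm.ne'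
    rcases h.extreme_ne_zero with hP | hP
    · exact hm' (neg_eq_zero.1 (zero_dvd_iff.1 (hdvd _ (by simp) hP)))
    · exact hm' (zero_dvd_iff.1 (hdvd _ (by simp) hP))
  have hk : 0 < d.natAbs := Int.natAbs_pos.2 hd0
  have hk' : (0 : ℝ) < d.natAbs := by exact_mod_cast hk
  have habs : ((d.natAbs : ℕ) : ℝ) = |(d : ℝ)| := by rw [Nat.cast_natAbs, Int.cast_abs]
  set r : ℝ≥0 := ⟨t₀ / d.natAbs, by positivity⟩ with hr
  have hr0 : 0 < r := NNReal.coe_pos.1 (by show 0 < t₀ / d.natAbs; positivity)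
  have hrid : S r = ContinuousLinearMap.id ℂ X := by
    rw [h.apply_eq_id_iff ht₀]
    intro n hn hP
    obtain ⟨c, rfl⟩ := hdvd n hn hP
    refine ⟨d.sign * c, ?_⟩
    have hs : (d : ℝ) = d.sign * d.natAbs := by
      rw [← Int.cast_natCast (R := ℝ) d.natAbs, ← Int.cast_mul, Int.sign_mul_natAbs]
    show ((d * c : ℤ) : ℝ) * (t₀ / d.natAbs) = _
    rw [Int.cast_mul, Int.cast_mul, hs]
    field_simp
  refine ⟨⟨r, hr0, hrid⟩, d.natAbs, hk, ?_⟩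
  suffices hper : period S = r by rw [hper]; rfl
  refine IsLeast.csInf_eq ⟨⟨hr0, hrid⟩, fun s hs => ?_⟩
  obtain ⟨hs0, hsid⟩ := hs
  rw [h.apply_eq_id_iff ht₀] at hsid
  -- For any `s` with `S s = id`, the integers `n` with `n s ∈ t₀ℤ` form an ideal containing the
  -- active indices, hence `d`. So `|d| s` is a nonzero multiple of `t₀`, which gives `s ≥ t₀ /
  -- |d|`.
  let I : Ideal ℤ :=
    { carrier := {n | ∃ z : ℤ, (n : ℝ) * s = z * t₀}
      add_mem' := by
        rintro a b ⟨z, hz⟩ ⟨w, hw⟩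
        exact ⟨z + w, by push_cast; linear_combination hz + hw⟩
      zero_mem' := ⟨0, by simp⟩
      smul_mem' := by
        rintro c a ⟨z, hz⟩
        exact ⟨c * z, by push_cast [smul_eq_mul]; linear_combination (c : ℝ) * hz⟩ }
  have hJI : J ≤ I := Ideal.span_le.2 fun n hn => hsid n hn.1 hn.2
  have hdJ : d ∈ J := by rw [hd]; exact Ideal.mem_span_singleton_self d
  obtain ⟨z, hz⟩ := hJI hdJ
  have hs0' : (0 : ℝ) < s := hs0
  have hz0 : z ≠ 0 := by
    rintro rfl
    have : (d : ℝ) ≠ 0 := by exact_mod_cast hd0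
    simp only [Int.cast_zero, zero_mul, mul_eq_zero] at hz
    rcases hz with hz | hz
    · exact this hz
    · exact hs0'.ne' hz
  have hz1 : (1 : ℝ) ≤ |(z : ℝ)| := by exact_mod_cast Int.one_le_abs hz0
  have hzabs := congrArg abs hz
  rw [abs_mul, abs_mul, abs_of_pos hs0', abs_of_pos ht₀, ← habs] at hzabs
  rw [← NNReal.coe_le_coe]
  show t₀ / d.natAbs ≤ s
  rw [div_le_iff₀ hk']
  nlinarith

end IsFiniteFourierExpansion

variable [ContinuousSMul ℂ X]

/-- The index set and the vectors `y n` are arbitrary so that the lemma serves both the full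
expansion and a single eigenvector. -/
theorem hasRightDerivAtZero_exp_sum {s : Finset ℤ} {x : X} {y : ℤ → X}
    (hS : ∀ t : ℝ≥0, S t x = ∑ n ∈ s,
      Complex.exp (2 * Real.pi * Complex.I * n * (t : ℝ) / t₀) • y n)
    (hx : ∑ n ∈ s, y n = x) :
    HasRightDerivAtZero S x (∑ n ∈ s, (2 * Real.pi * Complex.I * n / t₀ : ℂ) • y n) := by
  have h : Tendsto (fun t : ℝ≥0 => ∑ n ∈ s, (((t : ℝ) : ℂ)⁻¹ *
      (Complex.exp ((2 * Real.pi * Complex.I * n / t₀) * (t : ℝ)) - 1)) • y n)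
      (𝓝[>] (0 : ℝ≥0)) (𝓝 (∑ n ∈ s, (2 * Real.pi * Complex.I * n / t₀ : ℂ) • y n)) :=
    tendsto_finsetSum _ fun n _ => (tendsto_inv_mul_exp_sub_one _).smul_const (y n)
  refine h.congr fun t => ?_
  rw [hS t, ← hx, ← Finset.sum_sub_distrib, Finset.smul_sum]
  refine Finset.sum_congr rfl fun n _ => ?_
  rw [mul_smul, sub_smul, one_smul, div_mul_eq_mul_div]

theorem mem_pointSpectrum_of_apply_eq_exp_smul [T2Space X] {p : ℝ} {n : ℤ}
    {y : X} (hy0 : y ≠ 0)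
    (hy : ∀ t : ℝ≥0, S t y = Complex.exp (2 * Real.pi * Complex.I * n * (t : ℝ) / p) • y) :
    (2 * Real.pi * Complex.I * n / p : ℂ) ∈ pointSpectrum (generator S) := by
  have hd : HasRightDerivAtZero S y ((2 * Real.pi * Complex.I * n / p : ℂ) • y) := by
    have := hasRightDerivAtZero_exp_sum (S := S) (s := {n}) (x := y) (y := fun _ => y) (t₀ := p)
      (by simpa using hy) (by simp)
    simpa using this
  rw [← mem_graph_generator_iff, LinearPMap.mem_graph_iff] at hd
  obtain ⟨z, hz, hAz⟩ := hd
  simp only at hz hAz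
  intro hinj
  have h0 := @hinj z 0 (by simp [hz, hAz])
  rw [h0] at hz
  exact hy0 hz.symm

namespace IsFiniteFourierExpansion

theorem generator_eq [T2Space X] (h : IsFiniteFourierExpansion t₀ (fun t x => S t x) m P) :
    generator S = LinearMap.toPMap
      ((∑ n ∈ Finset.Icc (-(m : ℤ)) m,
        (2 * Real.pi * Complex.I * n / t₀ : ℂ) • P n : X →L[ℂ] X) : X →ₗ[ℂ] X) ⊤ := by
  have hder : ∀ x, HasRightDerivAtZero S x (∑ n ∈ Finset.Icc (-(m : ℤ)) m,
      (2 * Real.pi * Complex.I * n / t₀ : ℂ) • P n x) := fun x =>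
    hasRightDerivAtZero_exp_sum (fun t => h.expansion t x) (h.sum_proj_apply x)
  refine LinearPMap.eq_of_eq_graph (Submodule.ext fun z => ?_)
  obtain ⟨x, y⟩ := z
  rw [mem_graph_generator_iff, LinearPMap.mem_graph_iff]
  constructor
  · intro hy
    refine ⟨⟨x, trivial⟩, rfl, ?_⟩
    rw [hy.unique (hder x)]
    simp
  · rintro ⟨⟨x', hx'⟩, rfl, rfl⟩
    simpa using hder x'

theorem isBounded_pointSpectrum [T2Space X]
    (h : IsFiniteFourierExpansion t₀ (fun t x => S t x) m P) :
    Bornology.IsBounded (pointSpectrum (generator S)) := by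
  refine (((Finset.Icc (-(m : ℤ)) m).finite_toSet.image
    fun n : ℤ => (2 * Real.pi * Complex.I * n / t₀ : ℂ)).isBounded).subset fun μ hμ => ?_
  rw [h.generator_eq] at hμ
  simp only [pointSpectrum, Set.mem_ofPred_eq, Function.Injective, not_forall] at hμ
  obtain ⟨⟨x, hx⟩, ⟨y, hy⟩, hxy, hne⟩ := hμ
  -- `z` is an eigenvector for `μ`; any `P n` with `P n z ≠ 0` forces `μ = 2πin/t₀`.
  set z := x - y with hz
  have hz0 : z ≠ 0 := fun h0 => hne (Subtype.ext (sub_eq_zero.1 h0))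
  have hAz : ∑ n ∈ Finset.Icc (-(m : ℤ)) m, (2 * Real.pi * Complex.I * n / t₀ : ℂ) • P n z
      = μ • z := by
    have hA : ∀ w, ∑ n ∈ Finset.Icc (-(m : ℤ)) m,
        (2 * Real.pi * Complex.I * n / t₀ : ℂ) • P n w =
        (∑ n ∈ Finset.Icc (-(m : ℤ)) m, (2 * Real.pi * Complex.I * n / t₀ : ℂ) • P n :
          X →L[ℂ] X) w := fun w => by simp
    rw [hA, hz, map_sub, smul_sub]
    exact (sub_eq_sub_iff_sub_eq_sub.1 hxy).symm
  obtain ⟨n, hn, hPn⟩ : ∃ n ∈ Finset.Icc (-(m : ℤ)) m, P n z ≠ 0 := by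
    by_contra! hall
    exact hz0 (by rw [← h.sum_proj_apply z]; exact Finset.sum_eq_zero hall)
  refine ⟨n, hn, ?_⟩
  have h1 := congrArg (P n) hAz
  rw [h.proj_apply_sum hn, map_smul] at h1
  exact smul_left_injective ℂ hPn h1

theorem stronglyContinuous (h : IsFiniteFourierExpansion t₀ (fun t x => S t x) m P) :
    StronglyContinuous S := by
  intro x
  simp only [fun t => h.expansion t x]
  fun_prop

end IsFiniteFourierExpansion

end Expansion

/-! ### Eigenvectors, orthogonality and Fourier inversion -/

section FourierOperators

variable {X : Type*} [AddCommGroup X] [Module ℂ X] [Module ℝ X] [IsScalarTower ℝ ℂ X]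
  [UniformSpace X] [IsUniformAddGroup X] [ContinuousSMul ℂ X] [LocallyConvexSpace ℝ X]
  [T2Space X] {p : ℝ} [Fact (0 < p)] {S : ℝ≥0 → X →L[ℂ] X}

/-- Testing with `f ∘ T(b)` translates the scalar function by `b`; by invariance of Haar measure
this multiplies its `n`-th coefficient by `fourier n b`. -/
theorem circleAction_apply_fourierCoeff_operator (hS : IsSemigroup S)
    (hp : S p.toNNReal = ContinuousLinearMap.id ℂ X) {n : ℤ} {P : X →L[ℂ] X}
    (hP : ∀ (f : X →L[ℂ] ℂ) (x : X),
      f (P x) = fourierCoeff (fun a => f (circleAction p S a x)) n) (b : AddCircle p) (x : X) :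
    circleAction p S b (P x) = fourier n b • P x := by
  refine eq_of_forall_dual_apply_eq fun f => ?_
  have h1 := hP (f.comp (circleAction p S b)) x
  rw [ContinuousLinearMap.comp_apply] at h1
  have h2 : fourierCoeff (fun a => f (circleAction p S a x)) n =
      fourier (-n) b * fourierCoeff (fun a => f (circleAction p S (b + a) x)) n := by
    simp only [fourierCoeff]
    rw [← MeasureTheory.integral_const_mul, ← MeasureTheory.integral_add_left_eq_self _ b]
    refine MeasureTheory.integral_congr_ae (Eventually.of_forall fun a => ?_)
    simp only [smul_eq_mul, fourier_apply, smul_add, AddCircle.toCircle_add, Circle.coe_mul]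
    ring
  have h3 : (fourier n b : ℂ) * fourier (-n) b = 1 := by
    rw [← fourier_add, add_neg_cancel, fourier_zero]
  rw [h1, map_smul, hP, h2, smul_eq_mul, ← mul_assoc, h3, one_mul]
  simp only [circleAction_add hS hp, ContinuousLinearMap.comp_apply]

theorem fourierCoeff_operator_apply_eigenvector {n : ℤ} {P : X →L[ℂ] X}
    (hP : ∀ (f : X →L[ℂ] ℂ) (x : X),
      f (P x) = fourierCoeff (fun a => f (circleAction p S a x)) n) {j : ℤ} {y : X}
    (hy : ∀ a, circleAction p S a y = fourier j a • y) :
    P y = if n = j then y else 0 := by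
  refine eq_of_forall_dual_apply_eq fun f => ?_
  have h1 : (fun a => f (circleAction p S a y)) = fun a => f y * fourier j a := by
    ext a
    rw [hy, map_smul, smul_eq_mul, mul_comm]
  rw [hP, h1, fourierCoeff.const_mul, fourierCoeff_fourier]
  by_cases h : n = j <;> simp [h]

/-- A continuous scalar function with finitely many nonzero Fourier coefficients has a summable
series, which converges to it pointwise; functionals separate points. -/
theorem circleAction_eq_sum (hS : IsSemigroup S) (hc : StronglyContinuous S)
    (hp : S p.toNNReal = ContinuousLinearMap.id ℂ X) {P : ℤ → X →L[ℂ] X}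
    (hP : ∀ (n : ℤ) (f : X →L[ℂ] ℂ) (x : X),
      f (P n x) = fourierCoeff (fun a => f (circleAction p S a x)) n) {s : Finset ℤ}
    (hs : ∀ n ∉ s, P n = 0) (a : AddCircle p) (x : X) :
    circleAction p S a x = ∑ n ∈ s, fourier n a • P n x := by
  refine eq_of_forall_dual_apply_eq fun f => ?_
  let F : C(AddCircle p, ℂ) :=
    ⟨fun a => f (circleAction p S a x), f.continuous.comp (continuous_circleAction hS hc hp x)⟩
  have hF : ∀ n, fourierCoeff F n = f (P n x) := fun n => (hP n f x).symm
  have hF0 : ∀ n ∉ s, fourierCoeff F n = 0 := fun n hn => by rw [hF, hs n hn]; simp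
  have h1 := has_pointwise_sum_fourier_series_of_summable (f := F)
    (summable_of_ne_finset_zero hF0) a
  have h2 : HasSum (fun n => fourierCoeff F n • fourier n a)
      (∑ n ∈ s, fourierCoeff F n • (fourier n a : ℂ)) :=
    hasSum_sum_of_ne_finset_zero fun n hn => by rw [hF0 n hn, zero_smul]
  have h3 : f (circleAction p S a x) = _ := h1.unique h2
  rw [h3, map_sum]
  refine Finset.sum_congr rfl fun n _ => ?_
  rw [hF, map_smul, smul_eq_mul, smul_eq_mul, mul_comm]

end FourierOperators

/-! ### The period is attained -/

section Period

variable {X : Type*} [AddCommGroup X] [Module ℂ X] [TopologicalSpace X] [T2Space X]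
  {S : ℝ≥0 → X →L[ℂ] X}

/-- Strong continuity makes `{s | S s = id}` closed, so it contains the infimum. -/
theorem apply_period_eq_id (hc : StronglyContinuous S) (hper : IsPeriodic S) :
    S (period S) = ContinuousLinearMap.id ℂ X := by
  have hclosed : IsClosed {s : ℝ≥0 | S s = ContinuousLinearMap.id ℂ X} := by
    have : {s : ℝ≥0 | S s = ContinuousLinearMap.id ℂ X} = ⋂ x, {s | S s x = x} := by
      ext s
      simp [ContinuousLinearMap.ext_iff]
    rw [this]
    exact isClosed_iInter fun x => isClosed_eq (hc x) continuous_const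
  have hsub : {s : ℝ≥0 | 0 < s ∧ S s = ContinuousLinearMap.id ℂ X} ⊆
      {s : ℝ≥0 | S s = ContinuousLinearMap.id ℂ X} := fun s hs => hs.2
  exact closure_minimal hsub hclosed (csInf_mem_closure hper (OrderBot.bddBelow _))

end Period

/-! ### From bounded point spectrum to the finite expansion -/

section FiniteExpansion

variable {X : Type*} [AddCommGroup X] [Module ℂ X] [Module ℝ X] [IsScalarTower ℝ ℂ X]
  [UniformSpace X] [IsUniformAddGroup X] [ContinuousSMul ℂ X] [LocallyConvexSpace ℝ X]
  [T2Space X] [QuasiCompleteSpace ℂ X] {S : ℝ≥0 → X →L[ℂ] X}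

theorem exists_isFiniteFourierExpansion {t₀ : ℝ} (ht₀ : 0 < t₀) (hS : IsSemigroup S)
    (hper : IsPeriodic S) (hc : StronglyContinuous S) (he : LocallyEquicontinuous S)
    (hb : Bornology.IsBounded (pointSpectrum (generator S))) {k : ℕ} (hk : 0 < k)
    (hkper : (period S : ℝ) = t₀ / k) :
    ∃ m : ℕ, 0 < m ∧ ∃ P : ℤ → X →L[ℂ] X,
      IsFiniteFourierExpansion t₀ (fun t x => S t x) m P := by
  have hk' : (0 : ℝ) < k := by exact_mod_cast hk
  have hfact : Fact (0 < t₀) := ⟨ht₀⟩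
  have hp : S t₀.toNNReal = ContinuousLinearMap.id ℂ X := by
    have h1 := hS.map_add_nsmul_of_eq_id (apply_period_eq_id hc hper) 0 k
    have h2 : t₀.toNNReal = 0 + k • period S := by
      apply NNReal.coe_injective
      push_cast
      rw [Real.coe_toNNReal _ ht₀.le, hkper, nsmul_eq_mul]
      field_simp
      simp
    rw [h2, h1, hS.map_zero]
  choose P hP using fun n => exists_fourierCoeff_operator (p := t₀) hS hc he hp n
  have hexp : ∀ (n : ℤ) (t : ℝ≥0), (fourier n (((t : ℝ) : AddCircle t₀)) : ℂ) =
      Complex.exp (2 * Real.pi * Complex.I * n * (t : ℝ) / t₀) := fun n t => fourier_coe_apply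
  have heig : ∀ n b x, circleAction t₀ S b (P n x) = (fourier n b : ℂ) • P n x :=
    fun n => circleAction_apply_fourierCoeff_operator hS hp (hP n)
  have hspec : ∀ n, P n ≠ 0 → (2 * Real.pi * Complex.I * n / t₀ : ℂ) ∈
      pointSpectrum (generator S) := by
    intro n hn
    obtain ⟨x, hx⟩ : ∃ x, P n x ≠ 0 := by
      by_contra! hall
      exact hn (ContinuousLinearMap.ext hall)
    refine mem_pointSpectrum_of_apply_eq_exp_smul hx fun t => ?_
    rw [← circleAction_coe hS hp t, heig, hexp]
  obtain ⟨R, hR⟩ := hb.exists_norm_le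
  -- The bound `|2πin/t₀| ≤ R` means `|n| ≤ R t₀ / (2π)`.
  obtain ⟨M, hM⟩ := exists_nat_ge (R * t₀ / (2 * Real.pi))
  have hbound : ∀ n, P n ≠ 0 → n.natAbs ≤ M := by
    intro n hn
    have h1 := hR _ (hspec n hn)
    have h2 : ‖(2 * Real.pi * Complex.I * n / t₀ : ℂ)‖ = 2 * Real.pi * |(n : ℝ)| / t₀ := by
      simp [abs_of_pos Real.pi_pos, abs_of_pos ht₀]
    rw [h2, div_le_iff₀ ht₀] at h1
    have h3 : |(n : ℝ)| ≤ M := by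
      refine le_trans ?_ hM
      rw [le_div_iff₀ (by positivity)]
      linarith
    have h4 : ((n.natAbs : ℕ) : ℝ) ≤ M := by rwa [Nat.cast_natAbs, Int.cast_abs]
    exact_mod_cast h4
  have hfin : {n : ℤ | P n ≠ 0}.Finite :=
    (Finset.Icc (-(M : ℤ)) M).finite_toSet.subset fun n hn => by
      have := hbound n hn
      simp only [Finset.coe_Icc, Set.mem_Icc]
      omega
  -- The exact maximum of `|n|`, rather than the bound `M`, ensures that `P (-m)` or `P m` is
  -- nonzero.
  set m : ℕ := hfin.toFinset.sup Int.natAbs with hm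
  have hle : ∀ n, P n ≠ 0 → n.natAbs ≤ m := fun n hn =>
    Finset.le_sup (f := Int.natAbs) (hfin.mem_toFinset.2 hn)
  have hzero : ∀ n ∉ Finset.Icc (-(m : ℤ)) m, P n = 0 := by
    intro n hn
    by_contra hP0
    have := hle n hP0
    rw [Finset.mem_Icc] at hn
    omega
  have hsum : ∀ (t : ℝ≥0) (x : X), S t x = ∑ n ∈ Finset.Icc (-(m : ℤ)) m,
      Complex.exp (2 * Real.pi * Complex.I * n * (t : ℝ) / t₀) • P n x := by
    intro t x
    rw [← circleAction_coe hS hp t, circleAction_eq_sum hS hc hp hP hzero]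
    simp only [hexp]
  -- If `m = 0`, then `S` is constantly the identity, so half the period would also be admissible in
  -- the infimum, although the period `t₀ / k` is positive.
  have hmpos : 0 < m := by
    by_contra! hm0
    have hm0' : m = 0 := by omega
    have hid : ∀ t, S t = ContinuousLinearMap.id ℂ X := by
      intro t
      rw [← hS.map_zero]
      ext x
      rw [hsum t, hsum 0, hm0']
      simp
    have hpos : 0 < period S := by
      rw [← NNReal.coe_pos, hkper]
      positivity
    have hhalf : period S ≤ period S / 2 :=
      csInf_le (OrderBot.bddBelow _) ⟨half_pos hpos, hid _⟩
    exact (NNReal.half_lt_self hpos.ne').not_ge hhalf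
  -- The supremum over the empty set is `0`, which `hmpos` excludes.
  have hne : hfin.toFinset.Nonempty := by
    rw [Finset.nonempty_iff_ne_empty]
    intro hempty
    rw [hm, hempty] at hmpos
    simp at hmpos
  obtain ⟨n₀, hn₀, hmn₀⟩ := Finset.exists_mem_eq_sup _ hne Int.natAbs
  rw [hfin.mem_toFinset, Set.mem_ofPred_eq] at hn₀
  rw [← hm] at hmn₀
  have hPP : ∀ n j x, P n (P j x) = if n = j then P j x else 0 := fun n j x =>
    fourierCoeff_operator_apply_eigenvector (hP n) fun a => heig j a x
  refine ⟨m, hmpos, P, ?_, ?_, ?_, ?_, hsum⟩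
  · intro n _
    ext x
    rw [ContinuousLinearMap.comp_apply, hPP, if_pos rfl]
  · intro n _ j _ hjn
    ext x
    rw [ContinuousLinearMap.comp_apply, hPP, if_neg hjn.symm, zero_apply]
  · rcases Int.natAbs_eq n₀ with h | h
    · right
      rwa [hmn₀, ← h]
    · left
      rwa [hmn₀, ← h]
  · ext x
    have h0 := hsum 0 x
    rw [hS.map_zero] at h0
    simpa using h0.symm

end FiniteExpansion

end LCSemigroup

theorem mainTheorem12 {X : Type*} [AddCommGroup X] [Module ℂ X] [Module ℝ X]
    [IsScalarTower ℝ ℂ X] [UniformSpace X] [IsUniformAddGroup X] [ContinuousSMul ℂ X]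
    [LocallyConvexSpace ℝ X] [T2Space X] [QuasiCompleteSpace ℂ X]
    (t₀ : ℝ) (ht₀ : 0 < t₀) (T : ℝ≥0 → X → X) :
    ((∃ S : ℝ≥0 → X →L[ℂ] X, (∀ (t : ℝ≥0) (x : X), S t x = T t x) ∧
        LCSemigroup.IsSemigroup S ∧
        LCSemigroup.IsPeriodic S ∧
        LCSemigroup.StronglyContinuous S ∧
        LCSemigroup.LocallyEquicontinuous S ∧
        (LCSemigroup.generator S).domain = ⊤ ∧
        Bornology.IsBounded (LCSemigroup.pointSpectrum (LCSemigroup.generator S)) ∧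
        ∃ k : ℕ, 0 < k ∧ (LCSemigroup.period S : ℝ) = t₀ / k) ↔
      ∃ m : ℕ, 0 < m ∧ ∃ P : ℤ → X →L[ℂ] X,
        LCSemigroup.IsFiniteFourierExpansion t₀ T m P) ∧
    ∀ S : ℝ≥0 → X →L[ℂ] X, (∀ (t : ℝ≥0) (x : X), S t x = T t x) →
      ∀ m : ℕ, 0 < m → ∀ P : ℤ → X →L[ℂ] X,
        LCSemigroup.IsFiniteFourierExpansion t₀ T m P →
          LCSemigroup.generator S =
            LinearMap.toPMap
              ((∑ n ∈ Finset.Icc (-(m : ℤ)) m,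
                (2 * Real.pi * Complex.I * n / t₀ : ℂ) • P n : X →L[ℂ] X) : X →ₗ[ℂ] X) ⊤ := by
  refine ⟨⟨?_, ?_⟩, ?_⟩
  · rintro ⟨S, hST, hS, hper, hc, he, -, hb, k, hk, hkper⟩
    obtain rfl : (fun t x => S t x) = T := funext fun t => funext fun x => hST t x
    exact LCSemigroup.exists_isFiniteFourierExpansion ht₀ hS hper hc he hb hk hkper
  · rintro ⟨m, hm, P, h⟩
    -- `T` is only a family of maps; the expansion itself supplies continuous linear operators.
    obtain ⟨S, rfl⟩ : ∃ S : ℝ≥0 → X →L[ℂ] X, (fun t x => S t x) = T :=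
      ⟨fun t => ∑ n ∈ Finset.Icc (-(m : ℤ)) m,
        Complex.exp (2 * Real.pi * Complex.I * n * (t : ℝ) / t₀) • P n,
        funext fun t => funext fun x => by simp [h.expansion t x]⟩
    obtain ⟨hper, hk⟩ := h.exists_period_eq ht₀ hm
    refine ⟨S, fun _ _ => rfl, h.isSemigroup, hper, h.stronglyContinuous,
      h.locallyEquicontinuous, ?_, h.isBounded_pointSpectrum, hk⟩
    rw [h.generator_eq]
    rfl
  · intro S hST m _ P h
    obtain rfl : (fun t x => S t x) = T := funext fun t => funext fun x => hST t x
    exact h.generator_eq
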